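/- Let $\mathcal H$ be a finite dimensional real or complex inner product space with inner product $(\cdot,\cdot)$, let $A:\mathcal H\to\mathcal H$ be Hermitian and positive definite, and let $(x,y)_A=(x,Ay)$. For a subspace $\mathcal X$ and a Hermitian operator $T$, let $P_{\mathcal X}$ be the orthogonal projector onto $\mathcal X$ and $\Lambda((P_{\mathcal X}T)|_{\mathcal X})$ the vector of eigenvalues of $(P_{\mathcal X}T)|_{\mathcal X}:\mathcal X\to\mathcal X$, in decreasing order and repeated according to multiplicity. The vector $\Theta(\mathcal X,\mathcal Y)$ of the $\dim\mathcal X$ principal angles from $\mathcal X$ to $\mathcal Y$, with entries in $[0,\pi/2]$ in decreasing order, is defined by the condition that the entries of $\cos^2\Theta(\mathcal X,\mathcal Y)$ are the eigenvalues of $(P_{\mathcal X}P_{\mathcal Y})|_{\mathcal X}$ in increasing order; $\Theta_A(\mathcal X,\mathcal Y)$ is the vector of principal angles from $\mathcal X$ to $\mathcal Y$ defined in the same way with $(\cdot,\cdot)_A$ in place of $(\cdot,\cdot)$. For $x,y\in\mathbb R^m$, $x\prec_w y$ means that for each $k=1,\dots,m$ the sum of the $k$ largest entries of $x$ is at most the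 sum of the $k$ largest entries of $y$. Inequalities between vectors or between vectors and scalars, quotients, and functions of vectors are taken entrywise. Theorem. Let $\mathcal X,\mathcal Y$ be subspaces of $\mathcal H$ with $m=\dim\mathcal X\le\dim\mathcal Y$ and $\Theta(\mathcal X,\mathcal Y)<\pi/2$. Let $\mathcal X$ be $A$-invariant and correspond to the smallest eigenvalues of $A$, i.e. the eigenvalues of $A$ on $\mathcal X$ are the $m$ smallest eigenvalues of $A$, counting multiplicities. Let $\Lambda_{\mathcal X}=\Lambda((P_{\mathcal X}A)|_{\mathcal X})$, let $\Lambda_{\mathcal Y}$ be the vector of the $m$ smallest (counting multiplicities) eigenvalues of $(P_{\mathcal Y}A)|_{\mathcal Y}$ in decreasing order, and let $\Theta_A=\Theta_A(\mathcal X,\mathcal Y)$. Then $\Lambda_{\mathcal X}>0$, $\Lambda_{\mathcal Y}>0$ and $\Theta_A<\pi/2$, so that all quotients and tangents below are well defined, and $$0\le 1-\frac{\Lambda_{\mathcal X}}{\Lambda_{\mathcal Y}}\le\max\{\sin^2\Theta_A\},$$ $$0\le\log\frac{\Lambda_{\mathcal Y}}{\Lambda_{\mathcal X}}\prec_w\log\left(1+\tan^2\Theta_A\right),$$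 $$0\le\frac{\Lambda_{\mathcal Y}}{\Lambda_{\mathcal X}}-1\prec_w\tan^2\Theta_A.$$ -/

import Mathlib

namespace RayleighRitz

open Module

section Vectors

/-- The decreasing rearrangement `x↓` of a real vector. -/
noncomputable def decreasing {n : ℕ} (x : Fin n → ℝ) : Fin n → ℝ :=
  fun i => x (Tuple.sort x i.rev)

/-- Weak (sub-)majorization `x ≺_w y`: for `k = 1, …, n` the sum of the `k` largest entries of `x`
is at most the sum of the `k` largest entries of `y`. -/
def WeakMajorized {n : ℕ} (x y : Fin n → ℝ) : Prop :=
  ∀ k : ℕ, 1 ≤ k → k ≤ n →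
    ∑ i : Fin n with i.val < k, decreasing x i ≤ ∑ i : Fin n with i.val < k, decreasing y i

/-- The last `m` entries of a vector of length `n ≥ m`, in the same order. For a decreasing vector
these are its `m` smallest entries, again in decreasing order. -/
def lastEntries {m n : ℕ} (h : m ≤ n) (v : Fin n → ℝ) : Fin m → ℝ :=
  fun i => v ⟨n - m + i.val, by omega⟩

end Vectors

section InnerProduct

variable {𝕜 : Type*} [RCLike 𝕜] {H : Type*} [NormedAddCommGroup H] [InnerProductSpace 𝕜 H]
  [FiniteDimensional 𝕜 H]

/-- The Rayleigh–Ritz operator `(P_X T)|_X : X → X`. -/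
noncomputable def ritzOperator (T : H →ₗ[𝕜] H) (X : Submodule 𝕜 H) : X →ₗ[𝕜] X :=
  (X.orthogonalProjectionOnto : H →ₗ[𝕜] X) ∘ₗ T ∘ₗ X.subtype

theorem ritzOperator_isSymmetric {T : H →ₗ[𝕜] H} (hT : T.IsSymmetric) (X : Submodule 𝕜 H) :
    (ritzOperator T X).IsSymmetric := by
  intro x y
  have h1 : inner 𝕜 (ritzOperator T X x) y = inner 𝕜 (T x) (y : H) :=
    X.inner_orthogonalProjectionOnto_eq_of_mem_right y (T x)
  have h2 : inner 𝕜 x (ritzOperator T X y) = inner 𝕜 (x : H) (T y) :=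
    X.inner_orthogonalProjectionOnto_eq_of_mem_left x (T y)
  rw [h1, h2]
  exact hT x y

/-- The vector `Λ((P_X T)|_X)` of Ritz values of the Hermitian operator `T` on the subspace `X` of
dimension `m`, in decreasing order and repeated according to multiplicity. -/
noncomputable def ritzValues {T : H →ₗ[𝕜] H} (hT : T.IsSymmetric) (X : Submodule 𝕜 H)
    {m : ℕ} (hX : finrank 𝕜 X = m) : Fin m → ℝ :=
  (ritzOperator_isSymmetric hT X).eigenvalues hX

/-- The vector `Θ(X, Y)` of principal angles from `X` to `Y`, in decreasing order:
`cos² Θ(X, Y) = Λ↑((P_X P_Y)|_X)`, with `0 ≤ Θ ≤ π/2`. -/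
noncomputable def principalAngles (X Y : Submodule 𝕜 H) {m : ℕ} (hX : finrank 𝕜 X = m) :
    Fin m → ℝ :=
  fun i => Real.arccos (Real.sqrt (ritzValues Y.starProjection_isSymmetric X hX i.rev))

/-- The subspace `X`, of dimension `m`, is invariant under the Hermitian operator `A` and
corresponds to the contiguous set of the smallest eigenvalues of `A`: its eigenvalues are the `m`
smallest eigenvalues of `A`, counting multiplicities. -/
def IsSmallestInvariant {A : H →ₗ[𝕜] H} (hA : A.IsSymmetric) (X : Submodule 𝕜 H)
    {m : ℕ} (hX : finrank 𝕜 X = m) : Prop :=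
  (∀ x ∈ X, A x ∈ X) ∧
    ritzValues hA X hX = lastEntries (hX ▸ X.finrank_le) (hA.eigenvalues rfl)

end InnerProduct

section EnergyInnerProduct

variable {𝕜 : Type*} [RCLike 𝕜] {H : Type*} [NormedAddCommGroup H] [InnerProductSpace 𝕜 H]

/-- `A` is Hermitian and positive definite. -/
structure IsPosDef (A : H →ₗ[𝕜] H) : Prop where
  isSymmetric : A.IsSymmetric
  pos : ∀ x : H, x ≠ 0 → 0 < RCLike.re (inner 𝕜 x (A x))

/-- The vector space `H`, to be equipped with the `A`-based scalar product
`(x, y)_A = (x, A y)`. -/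
@[nolint unusedArguments]
def EnergySpace (A : H →ₗ[𝕜] H) (_hA : IsPosDef A) : Type _ := H

namespace EnergySpace

variable {A : H →ₗ[𝕜] H} {hA : IsPosDef A}

instance : AddCommGroup (EnergySpace A hA) := inferInstanceAs (AddCommGroup H)

instance : Module 𝕜 (EnergySpace A hA) := inferInstanceAs (Module 𝕜 H)

/-- The identity map from `H` to `H` with the `A`-based scalar product. -/
def ofBase (hA : IsPosDef A) : H ≃ₗ[𝕜] EnergySpace A hA := LinearEquiv.refl 𝕜 H

/-- The `A`-based scalar product `(x, y)_A = (x, A y)`. -/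
@[reducible] def core (hA : IsPosDef A) : InnerProductSpace.Core 𝕜 (EnergySpace A hA) where
  inner x y := inner 𝕜 ((ofBase hA).symm x) (A ((ofBase hA).symm y))
  conj_inner_symm x y := by
    rw [inner_conj_symm]
    exact hA.isSymmetric _ _
  re_inner_nonneg x := by
    by_cases h : (ofBase hA).symm x = 0
    · simp [h]
    · exact (hA.pos _ h).le
  add_left x y z := by simp [inner_add_left]
  smul_left x y r := by simp [inner_smul_left]
  definite x h := by
    by_contra hx
    have h0 : (ofBase hA).symm x ≠ 0 := by simpa using hx
    have := hA.pos _ h0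
    rw [h] at this
    simp at this

noncomputable instance : NormedAddCommGroup (EnergySpace A hA) :=
  (core hA).toNormedAddCommGroup

noncomputable instance : InnerProductSpace 𝕜 (EnergySpace A hA) :=
  InnerProductSpace.ofCore (core hA).toCore

instance [FiniteDimensional 𝕜 H] : FiniteDimensional 𝕜 (EnergySpace A hA) :=
  inferInstanceAs (FiniteDimensional 𝕜 H)

end EnergySpace

/-- The vector `Θ_A(X, Y)` of principal angles from `X` to `Y` in the `A`-based scalar product. -/
noncomputable def energyAngles [FiniteDimensional 𝕜 H] {A : H →ₗ[𝕜] H} (hA : IsPosDef A)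
    (X Y : Submodule 𝕜 H) {m : ℕ} (hX : finrank 𝕜 X = m) : Fin m → ℝ :=
  principalAngles (X.map (EnergySpace.ofBase hA).toLinearMap)
    (Y.map (EnergySpace.ofBase hA).toLinearMap)
    (((EnergySpace.ofBase hA).finrank_map_eq X).trans hX)

end EnergyInnerProduct

end RayleighRitz

/-!
Two ideas carry the proof: a reduction to a comparison of quadratic forms on `X`, and a truncation
argument for products of eigenvalues over arbitrary index sets.

Let `cᵢ = cos² θᵢ` be the squared cosines of the angles in the energy scalar product, which are
positive (`energyCosSq_pos`), and `uᵢ ∈ X` the `A`-orthonormal principal vectors. Then `Y`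
contains the graph of a map from `X` to its `A`-orthogonal complement: there is `W : X → Y` with
`W x - x` `A`-orthogonal to `X` and `(W x, A W x) = ∑ |xᵢ|² / cᵢ`, while `(x, A x) = ∑ |xᵢ|²`
(`exists_energy_graph_map`). As `X` is `A`-invariant, `W x - x` is also orthogonal to `X` in the
original scalar product, so that `‖x‖ ≤ ‖W x‖`. By the min-max principle (`mul_eigenvalues_le`)
the Ritz values `ΛY` are then at most the eigenvalues of the form `∑ |xᵢ|² / cᵢ` on `X`, and
`1 / cᵢ = 1 + tan² θᵢ`.

It remains to bound products of `k` of the quotients `ΛY / ΛX` by the product of the `k` largest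
`ρᵢ = 1 / cᵢ`, a multiplicative inequality of Lidskii type. Let `r` be the `k`-th largest `ρᵢ` and
replace each `ρᵢ` by `max ρᵢ r` (`exists_eigenvalue_bounds`). The eigenvalues `ν` of the enlarged
form satisfy `ΛY ≤ ν` and `r ΛX ≤ ν`, and the product of all `ν / ΛX` is a determinant, the
product of all `max ρᵢ r`. Hence `k` of the quotients have a product of at most
`∏ max ρᵢ r / r ^ (m - k)`, which is the product of the `k` largest `ρᵢ` (`prod_div_le_prod`). The case `k = 1`
gives the bound with `sin²`, the logarithm gives the first majorization, and the convex increasing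
function `exp t - 1` turns it into the second (`WeakMajorized.exp_sub_one`). The lower bounds are
Courant–Fischer for `Y ⊆ H`, since `ΛX` consists of the smallest eigenvalues of `A`.
-/

namespace RayleighRitz

open Module

/-! ### Weak majorization of real vectors -/

theorem decreasing_antitone {n : ℕ} (x : Fin n → ℝ) : Antitone (decreasing x) :=
  fun _ _ h => Tuple.monotone_sort x (Fin.rev_le_rev.mpr h)

theorem decreasing_eq_self {n : ℕ} {x : Fin n → ℝ} (hx : Antitone x) : decreasing x = x := by
  have h : x ∘ Fin.revPerm = x ∘ Tuple.sort x := by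
    rw [Tuple.comp_sort_eq_comp_iff_monotone]
    exact fun i j h => hx (Fin.rev_le_rev.mpr h)
  funext i
  have := congrFun h i.rev
  simpa [decreasing] using this.symm

theorem decreasing_comp_of_monotone {n : ℕ} {f : ℝ → ℝ} (hf : Monotone f) (x : Fin n → ℝ) :
    decreasing (fun i => f (x i)) = fun i => f (decreasing x i) := by
  have h : (f ∘ x) ∘ Tuple.sort x = (f ∘ x) ∘ Tuple.sort (f ∘ x) := by
    rw [Tuple.comp_sort_eq_comp_iff_monotone, Function.comp_assoc]
    exact hf.comp (Tuple.monotone_sort x)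
  funext i
  exact (congrFun h i.rev).symm

/-- The sum of the `k` largest entries is a sum over some index set of size `k`. -/
theorem exists_sum_decreasing_eq {n : ℕ} (x : Fin n → ℝ) {k : ℕ} (hk : k ≤ n) :
    ∃ s : Finset (Fin n), s.card = k ∧
      ∑ i : Fin n with i.val < k, decreasing x i = ∑ i ∈ s, x i := by
  refine ⟨(Finset.univ.filter fun i : Fin n => i.val < k).map
    (Fin.revPerm.trans (Tuple.sort x)).toEmbedding, ?_, ?_⟩
  · rw [Finset.card_map, Fin.card_filter_val_lt, min_eq_right hk]
  · rw [Finset.sum_map]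
    rfl

theorem weakMajorized_of_sum_le {n : ℕ} {x y : Fin n → ℝ} (hy : Antitone y)
    (h : ∀ s : Finset (Fin n), s.Nonempty →
      ∑ i ∈ s, x i ≤ ∑ i : Fin n with i.val < s.card, y i) : WeakMajorized x y := by
  intro k hk hkn
  obtain ⟨s, hs, hsum⟩ := exists_sum_decreasing_eq x hkn
  rw [hsum, decreasing_eq_self hy, ← hs]
  exact h s (Finset.card_pos.mp (by omega))

/-- Abel summation: weights that are nonnegative and decreasing preserve the nonpositivity of the
partial sums. -/
theorem sum_range_mul_nonpos {w d : ℕ → ℝ} {n : ℕ} (hw : ∀ i < n, 0 ≤ w i)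
    (hanti : ∀ i, i + 1 < n → w (i + 1) ≤ w i)
    (hd : ∀ k ≤ n, ∑ i ∈ Finset.range k, d i ≤ 0) :
    ∑ i ∈ Finset.range n, w i * d i ≤ 0 := by
  have key : ∀ k, k + 1 ≤ n → ∑ i ∈ Finset.range (k + 1), w i * d i ≤
      w k * ∑ i ∈ Finset.range (k + 1), d i := by
    intro k
    induction k with
    | zero => intro _; simp
    | succ k ih =>
      intro hk
      have h1 := mul_le_mul_of_nonpos_right (hanti k (by omega)) (hd (k + 1) (by omega))
      rw [Finset.sum_range_succ, Finset.sum_range_succ d (k + 1), mul_add]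
      linarith [ih (by omega)]
  cases n with
  | zero => simp
  | succ n =>
    exact (key n le_rfl).trans
      (mul_nonpos_of_nonneg_of_nonpos (hw n (by omega)) (hd _ le_rfl))

theorem sum_filter_val_lt {n k : ℕ} (hk : k ≤ n) (x : Fin n → ℝ) :
    ∑ i : Fin n with i.val < k, x i =
      ∑ i ∈ Finset.range k, if h : i < n then x ⟨i, h⟩ else 0 := by
  refine Finset.sum_bij (fun i _ => i.val) (by simp) (fun _ _ _ _ h => Fin.ext h) ?_ (by simp)
  intro b hb
  have hb' := Finset.mem_range.mp hb
  exact ⟨⟨b, by omega⟩, by simpa using hb', rfl⟩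

/-- An increasing convex function preserves weak majorization; here for `t ↦ exp t - 1`. -/
theorem WeakMajorized.exp_sub_one {n : ℕ} {x y : Fin n → ℝ} (h : WeakMajorized x y) :
    WeakMajorized (fun i => Real.exp (x i) - 1) (fun i => Real.exp (y i) - 1) := by
  have hmono : Monotone fun t : ℝ => Real.exp t - 1 := fun s t hst => by
    simpa using hst
  intro k hk hkn
  rw [decreasing_comp_of_monotone hmono x, decreasing_comp_of_monotone hmono y,
    sum_filter_val_lt hkn, sum_filter_val_lt hkn, ← sub_nonpos, ← Finset.sum_sub_distrib]
  set a : ℕ → ℝ := fun i => if h : i < n then decreasing x ⟨i, h⟩ else 0 with ha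
  set b : ℕ → ℝ := fun i => if h : i < n then decreasing y ⟨i, h⟩ else 0 with hb
  -- The graph of `exp` lies above its tangent at `a i`.
  have htangent : ∀ s t : ℝ, Real.exp s - 1 - (Real.exp t - 1) ≤ Real.exp s * (s - t) := by
    intro s t
    have h1 := mul_le_mul_of_nonneg_left (Real.add_one_le_exp (t - s)) (Real.exp_pos s).le
    rw [← Real.exp_add, add_sub_cancel] at h1
    linarith
  have hle : ∑ i ∈ Finset.range k, Real.exp (a i) * (a i - b i) ≤ 0 := by
    refine sum_range_mul_nonpos (w := fun i => Real.exp (a i)) (d := fun i => a i - b i)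
      (fun i _ => (Real.exp_pos _).le) (fun i hi => ?_) (fun l hl => ?_)
    · have h1 : i + 1 < n := by omega
      have h2 : i < n := by omega
      simp only [ha, h1, h2, dif_pos, Real.exp_le_exp]
      exact decreasing_antitone x (by simp [Fin.le_def])
    · rcases Nat.eq_zero_or_pos l with rfl | hl0
      · simp
      · have := h l hl0 (hl.trans hkn)
        rw [sum_filter_val_lt (hl.trans hkn), sum_filter_val_lt (hl.trans hkn)] at this
        rw [Finset.sum_sub_distrib]
        linarith
  refine (Finset.sum_le_sum fun i hi => ?_).trans hle
  have h1 : i < n := by have := Finset.mem_range.mp hi; omega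
  simpa only [ha, hb, h1, dif_pos] using htangent _ _

/-- Passing from eigenvalue comparison at every truncation level `r` to products over
arbitrary index sets: the truncated vector `max ρ r` has all its excess over `r` in the first `k`
entries, and the factors outside `s` contribute at least `r` each. -/
theorem prod_div_le_prod {m : ℕ} {l μ ρ : Fin m → ℝ} (hl : ∀ i, 0 < l i) (hμ : ∀ i, 0 < μ i)
    (hρ : ∀ i, 0 < ρ i) (hanti : Antitone ρ)
    (h : ∀ r : ℝ, 0 < r → ∃ ν : Fin m → ℝ,
      ∏ i, ν i = (∏ i, max (ρ i) r) * ∏ i, l i ∧ ∀ i, μ i ≤ ν i ∧ r * l i ≤ ν i)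
    {s : Finset (Fin m)} (hs : s.Nonempty) :
    ∏ i ∈ s, μ i / l i ≤ ∏ i : Fin m with i.val < s.card, ρ i := by
  have hcard : s.card ≤ m := by simpa using s.card_le_univ
  have hpos := Finset.card_pos.mpr hs
  let j : Fin m := ⟨s.card - 1, by omega⟩
  obtain ⟨ν, hν, hle⟩ := h (ρ j) (hρ j)
  have hquot : ∏ i, ν i / l i = ∏ i, max (ρ i) (ρ j) := by
    rw [Finset.prod_div_distrib, hν, mul_div_cancel_right₀]
    exact (Finset.prod_pos fun i _ => hl i).ne'
  have hc1 : (Finset.univ.filter fun i : Fin m => ¬ i.val < s.card).card = sᶜ.card := by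
    have h1 := Finset.card_filter_add_card_filter_not (s := (Finset.univ : Finset (Fin m)))
      (fun i : Fin m => i.val < s.card)
    have h2 := Finset.card_add_card_compl s
    rw [Fin.card_filter_val_lt, min_eq_right hcard] at h1
    simp only [Finset.card_univ, Fintype.card_fin] at h1 h2
    omega
  have hmax : ∏ i, max (ρ i) (ρ j) =
      (∏ i : Fin m with i.val < s.card, ρ i) * ρ j ^ sᶜ.card := by
    rw [← Finset.prod_filter_mul_prod_filter_not Finset.univ (fun i : Fin m => i.val < s.card),
      ← hc1, ← Finset.prod_const]
    congr 1 <;> refine Finset.prod_congr rfl fun i hi => ?_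
    · refine max_eq_left (hanti ?_)
      have := (Finset.mem_filter.mp hi).2
      simp only [Fin.le_def, j]; omega
    · refine max_eq_right (hanti ?_)
      have := (Finset.mem_filter.mp hi).2
      simp only [Fin.le_def, j]; omega
  refine le_of_mul_le_mul_right ?_ (pow_pos (hρ j) sᶜ.card)
  rw [← hmax, ← hquot, ← Finset.prod_mul_prod_compl s, ← Finset.prod_const]
  refine mul_le_mul (Finset.prod_le_prod (fun i _ => (div_pos (hμ i) (hl i)).le)
    fun i _ => div_le_div_of_nonneg_right (hle i).1 (hl i).le)
    (Finset.prod_le_prod (fun i _ => (hρ j).le) fun i _ => (le_div_iff₀ (hl i)).mpr (hle i).2)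
    (Finset.prod_nonneg fun i _ => (hρ j).le)
    (Finset.prod_nonneg fun i _ => (div_pos ((hμ i).trans_le (hle i).1) (hl i)).le)

/-! ### Comparison of eigenvalues -/

section Comparison

variable {𝕜 : Type*} [RCLike 𝕜] {E : Type*} [NormedAddCommGroup E] [InnerProductSpace 𝕜 E]
  [FiniteDimensional 𝕜 E] {F : Type*} [NormedAddCommGroup F] [InnerProductSpace 𝕜 F]
  [FiniteDimensional 𝕜 F]

theorem re_inner_apply_self_eq_sum {T : E →ₗ[𝕜] E} (hT : T.IsSymmetric) {n : ℕ}
    (hn : finrank 𝕜 E = n) (x : E) :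
    RCLike.re (inner 𝕜 (T x) x) =
      ∑ i, hT.eigenvalues hn i * ‖(hT.eigenvectorBasis hn).repr x i‖ ^ 2 := by
  rw [← (hT.eigenvectorBasis hn).repr.inner_map_map, PiLp.inner_apply, map_sum]
  refine Finset.sum_congr rfl fun i _ => ?_
  rw [hT.eigenvectorBasis_apply_self_apply hn, ← smul_eq_mul, inner_smul_left,
    RCLike.conj_ofReal, RCLike.re_ofReal_mul, inner_self_eq_norm_sq]

/-- A form of the Courant–Fischer principle. Counting vanishing coordinates gives `x ≠ 0` in the
span of the eigenvectors of `S` for the eigenvalues from `i` on, whose image `L x` lies in the span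
of the eigenvectors of `T` for the eigenvalues up to `j`; compare Rayleigh quotients there. -/
theorem mul_eigenvalues_le {S : E →ₗ[𝕜] E} (hS : S.IsSymmetric) {T : F →ₗ[𝕜] F}
    (hT : T.IsSymmetric) {p q : ℕ} (hp : finrank 𝕜 E = p) (hq : finrank 𝕜 F = q)
    (L : E →ₗ[𝕜] F) {t : ℝ} (ht : 0 ≤ t) (hL : ∀ x, ‖x‖ ≤ ‖L x‖)
    (hpos : ∀ x, 0 ≤ RCLike.re (inner 𝕜 (S x) x))
    (h : ∀ x, t * RCLike.re (inner 𝕜 (T (L x)) (L x)) ≤ RCLike.re (inner 𝕜 (S x) x))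
    {i : Fin p} {j : Fin q} (hij : q + i.val ≤ p + j.val) :
    t * hT.eigenvalues hq j ≤ hS.eigenvalues hp i := by
  let bS := hS.eigenvectorBasis hp
  let bT := hT.eigenvectorBasis hq
  let Φ : E →ₗ[𝕜] ({k : Fin p // k < i} ⊕ {k : Fin q // j < k}) → 𝕜 := LinearMap.pi
    (Sum.elim (fun k => bS.toBasis.coord k.1) (fun k => bT.toBasis.coord k.1 ∘ₗ L))
  have hdim : finrank 𝕜 (({k : Fin p // k < i} ⊕ {k : Fin q // j < k}) → 𝕜) < finrank 𝕜 E := by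
    have h1 : Fintype.card {k : Fin p // k < i} = i := by
      rw [Fintype.card_of_subtype (Finset.Iio i) (fun _ => Finset.mem_Iio), Fin.card_Iio]
    have h2 : Fintype.card {k : Fin q // j < k} = q - 1 - j := by
      rw [Fintype.card_of_subtype (Finset.Ioi j) (fun _ => Finset.mem_Ioi), Fin.card_Ioi]
    rw [finrank_fintype_fun_eq_card, Fintype.card_sum, h1, h2, hp]
    omega
  obtain ⟨x, hx, hx0⟩ :=
    Submodule.exists_mem_ne_zero_of_ne_bot (LinearMap.ker_ne_bot_of_finrank_lt (f := Φ) hdim)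
  have hcoordS : ∀ k, k < i → bS.repr x k = 0 := fun k hk => by
    simpa [Φ] using congrFun (LinearMap.mem_ker.mp hx) (Sum.inl ⟨k, hk⟩)
  have hcoordT : ∀ k, j < k → bT.repr (L x) k = 0 := fun k hk => by
    simpa [Φ] using congrFun (LinearMap.mem_ker.mp hx) (Sum.inr ⟨k, hk⟩)
  have hupper : RCLike.re (inner 𝕜 (S x) x) ≤ hS.eigenvalues hp i * ‖x‖ ^ 2 := by
    rw [re_inner_apply_self_eq_sum hS hp, ← bS.repr.norm_map x, EuclideanSpace.norm_sq_eq,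
      Finset.mul_sum]
    refine Finset.sum_le_sum fun k _ => ?_
    rcases lt_or_ge k i with hk | hk
    · have := hcoordS k hk
      simp only [bS] at this ⊢
      simp [this]
    · exact mul_le_mul_of_nonneg_right (hS.eigenvalues_antitone hp hk) (by positivity)
  have hlower : hT.eigenvalues hq j * ‖L x‖ ^ 2 ≤ RCLike.re (inner 𝕜 (T (L x)) (L x)) := by
    rw [re_inner_apply_self_eq_sum hT hq, ← bT.repr.norm_map (L x), EuclideanSpace.norm_sq_eq,
      Finset.mul_sum]
    refine Finset.sum_le_sum fun k _ => ?_
    rcases lt_or_ge j k with hk | hk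
    · have := hcoordT k hk
      simp only [bT] at this ⊢
      simp [this]
    · exact mul_le_mul_of_nonneg_right (hT.eigenvalues_antitone hq hk) (by positivity)
  have hx1 : 0 < ‖x‖ ^ 2 := pow_pos (norm_pos_iff.mpr hx0) 2
  have hsq : ‖x‖ ^ 2 ≤ ‖L x‖ ^ 2 := pow_le_pow_left₀ (norm_nonneg x) (hL x) 2
  have hS0 : 0 ≤ hS.eigenvalues hp i := by
    by_contra hneg
    exact absurd ((hpos x).trans hupper) (not_le.mpr (mul_neg_of_neg_of_pos (not_le.mp hneg) hx1))
  refine le_of_mul_le_mul_right ?_ (hx1.trans_le hsq)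
  calc t * hT.eigenvalues hq j * ‖L x‖ ^ 2
      = t * (hT.eigenvalues hq j * ‖L x‖ ^ 2) := by ring
    _ ≤ t * RCLike.re (inner 𝕜 (T (L x)) (L x)) := mul_le_mul_of_nonneg_left hlower ht
    _ ≤ RCLike.re (inner 𝕜 (S x) x) := h x
    _ ≤ hS.eigenvalues hp i * ‖x‖ ^ 2 := hupper
    _ ≤ hS.eigenvalues hp i * ‖L x‖ ^ 2 := mul_le_mul_of_nonneg_left hsq hS0

end Comparison

/-! ### Diagonal operators -/

section Diagonal

variable {𝕜 : Type*} [RCLike 𝕜] {E : Type*} [AddCommGroup E] [Module 𝕜 E] {ι : Type*} [Fintype ι]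

/-- The operator with eigenvectors `b i` and real eigenvalues `τ i`. -/
noncomputable def diagonalOperator (b : Basis ι 𝕜 E) (τ : ι → ℝ) : E →ₗ[𝕜] E :=
  b.constr 𝕜 fun i => (τ i : 𝕜) • b i

theorem repr_diagonalOperator (b : Basis ι 𝕜 E) (τ : ι → ℝ) (x : E) (i : ι) :
    b.repr (diagonalOperator b τ x) i = τ i * b.repr x i := by
  classical
  simp [diagonalOperator, Basis.constr_apply_fintype, Finsupp.single_apply,
    RCLike.real_smul_eq_coe_mul, mul_comm]

theorem det_diagonalOperator (b : Basis ι 𝕜 E) (τ : ι → ℝ) :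
    LinearMap.det (diagonalOperator b τ) = ((∏ i, τ i : ℝ) : 𝕜) := by
  classical
  have h : LinearMap.toMatrix b b (diagonalOperator b τ) =
      Matrix.diagonal fun i => (τ i : 𝕜) := by
    ext i j
    rw [LinearMap.toMatrix_apply, repr_diagonalOperator, Basis.repr_self, Matrix.diagonal_apply,
      Finsupp.single_apply]
    by_cases hij : i = j
    · simp [hij]
    · simp [hij, Ne.symm hij]
  rw [← LinearMap.det_toMatrix b, h, Matrix.det_diagonal, RCLike.ofReal_prod]

end Diagonal

/-! ### The graph map of one subspace over another -/

section Graph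

variable {𝕜 : Type*} [RCLike 𝕜] {E : Type*} [NormedAddCommGroup E] [InnerProductSpace 𝕜 E]
  [FiniteDimensional 𝕜 E]

theorem inner_ritzOperator_left (T : E →ₗ[𝕜] E) (X : Submodule 𝕜 E) (x y : X) :
    inner 𝕜 (ritzOperator T X x) y = inner 𝕜 (T x) (y : E) :=
  X.inner_orthogonalProjectionOnto_eq_of_mem_right y (T x)

theorem inner_starProjection_self (Y : Submodule 𝕜 E) (x : E) :
    inner 𝕜 (Y.starProjection x) x = inner 𝕜 (Y.starProjection x) (Y.starProjection x) := by
  rw [← Submodule.inner_starProjection_left_eq_right,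
    Submodule.starProjection_eq_self_iff.mpr (Y.starProjection_apply_mem x)]

theorem ritzValues_starProjection_le_one (X Y : Submodule 𝕜 E) {m : ℕ}
    (hX : finrank 𝕜 X = m) (i : Fin m) : ritzValues Y.starProjection_isSymmetric X hX i ≤ 1 := by
  set hS := ritzOperator_isSymmetric Y.starProjection_isSymmetric X
  set v := hS.eigenvectorBasis hX i with hv
  have hnorm : ‖v‖ = 1 := (hS.eigenvectorBasis hX).orthonormal.1 i
  have h1 : RCLike.re (inner 𝕜 (ritzOperator Y.starProjection X v) v) = hS.eigenvalues hX i := by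
    rw [hS.apply_eigenvectorBasis hX i, inner_smul_left, RCLike.conj_ofReal,
      RCLike.re_ofReal_mul, inner_self_eq_norm_sq, ← hv, hnorm]
    simp
  change hS.eigenvalues hX i ≤ 1
  rw [← h1, inner_ritzOperator_left]
  refine (inner_starProjection_self Y (v : E) ▸ inner_self_eq_norm_sq (𝕜 := 𝕜) _).le.trans ?_
  have h2 : ‖Y.starProjection (v : E)‖ ≤ 1 :=
    (Y.norm_starProjection_apply_le _).trans hnorm.le
  exact pow_le_one₀ (norm_nonneg _) h2

/-- If all the cosines `√cᵢ` of the principal angles from `X` to `Y` are nonzero, then `Y` contains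
the graph of a map from `X` to `Xᗮ`; the squared norm on this graph is diagonal, with entries
`1/cᵢ`, in the basis of principal vectors of `X`. With `P` the projector onto `Y` and `S` the
compression of `P` to `X`, the parametrization of the graph by `X` is `P S⁻¹`. -/
theorem exists_graph_map (X Y : Submodule 𝕜 E) {m : ℕ} (hX : finrank 𝕜 X = m)
    (hc : ∀ i, 0 < ritzValues Y.starProjection_isSymmetric X hX i) :
    ∃ (u : OrthonormalBasis (Fin m) 𝕜 X) (W : X →ₗ[𝕜] Y),
      (∀ x, ‖W x‖ ^ 2 = ∑ i, (ritzValues Y.starProjection_isSymmetric X hX i)⁻¹ *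
        ‖u.repr x i‖ ^ 2) ∧
      ∀ x y : X, inner 𝕜 (x : E) ((W y : E) - y) = 0 := by
  set c := ritzValues Y.starProjection_isSymmetric X hX with hcdef
  set hS := ritzOperator_isSymmetric Y.starProjection_isSymmetric X
  set u := hS.eigenvectorBasis hX with hu
  set D := diagonalOperator u.toBasis fun i => (c i)⁻¹ with hD
  have hDrepr : ∀ x i, u.repr (D x) i = ((c i)⁻¹ : ℝ) * u.repr x i := fun x i => by
    simpa using repr_diagonalOperator u.toBasis (fun i => (c i)⁻¹) x i
  have hSD : ∀ x, ritzOperator Y.starProjection X (D x) = x := by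
    intro x
    apply u.repr.injective
    ext i
    have h0 : (c i : 𝕜) ≠ 0 := by exact_mod_cast (hc i).ne'
    have h1 := hS.eigenvectorBasis_apply_self_apply hX (D x) i
    rw [← hu, hDrepr] at h1
    refine h1.trans ?_
    change (c i : 𝕜) * _ = _
    push_cast
    field_simp
  have hinner : ∀ x y : X, inner 𝕜 (Y.starProjection (D x : E)) (y : E) = inner 𝕜 (x : E) y := by
    intro x y
    have h1 := inner_ritzOperator_left (Y.starProjection : E →ₗ[𝕜] E) X (D x) y
    rw [hSD] at h1
    exact h1.symm
  refine ⟨u, (Y.orthogonalProjectionOnto : E →ₗ[𝕜] Y) ∘ₗ X.subtype ∘ₗ D, fun x => ?_,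
    fun x y => ?_⟩
  · have h1 : ‖((Y.orthogonalProjectionOnto : E →ₗ[𝕜] Y) ∘ₗ X.subtype ∘ₗ D) x‖ ^ 2 =
        RCLike.re (inner 𝕜 x (D x)) := by
      rw [Submodule.coe_inner, ← hinner x (D x), inner_starProjection_self, inner_self_eq_norm_sq]
      rfl
    rw [h1, ← u.repr.inner_map_map, PiLp.inner_apply, map_sum]
    refine Finset.sum_congr rfl fun i _ => ?_
    rw [hDrepr, ← smul_eq_mul, inner_smul_right, RCLike.re_ofReal_mul, inner_self_eq_norm_sq]
  · change inner 𝕜 (x : E) (Y.starProjection (D y : E) - y) = 0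
    rw [inner_sub_right, ← inner_conj_symm, hinner, inner_conj_symm, sub_self]

end Graph

/-! ### The energy scalar product -/

section Energy

variable {𝕜 : Type*} [RCLike 𝕜] {H : Type*} [NormedAddCommGroup H] [InnerProductSpace 𝕜 H]
  {A : H →ₗ[𝕜] H}

theorem IsPosDef.re_inner_nonneg (hA : IsPosDef A) (x : H) :
    0 ≤ RCLike.re (inner 𝕜 (A x) x) := by
  rw [hA.isSymmetric x x]
  rcases eq_or_ne x 0 with rfl | hx
  · simp
  · exact (hA.pos x hx).le

variable [FiniteDimensional 𝕜 H]

theorem ritzValues_pos (hA : IsPosDef A) (X : Submodule 𝕜 H) {m : ℕ} (hX : finrank 𝕜 X = m)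
    (i : Fin m) : 0 < ritzValues hA.isSymmetric X hX i := by
  set hS := ritzOperator_isSymmetric hA.isSymmetric X
  set v := hS.eigenvectorBasis hX i with hv
  have hnorm : ‖v‖ = 1 := (hS.eigenvectorBasis hX).orthonormal.1 i
  have h1 : RCLike.re (inner 𝕜 (ritzOperator A X v) v) = hS.eigenvalues hX i := by
    rw [hS.apply_eigenvectorBasis hX i, inner_smul_left, RCLike.conj_ofReal,
      RCLike.re_ofReal_mul, inner_self_eq_norm_sq, ← hv, hnorm]
    simp
  change 0 < hS.eigenvalues hX i
  rw [← h1, inner_ritzOperator_left, hA.isSymmetric]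
  refine hA.pos _ fun h => ?_
  rw [Submodule.coe_eq_zero] at h
  simp [h] at hnorm

/-- The squared cosines of the principal angles from `X` to `Y` in the energy scalar product. -/
noncomputable def energyCosSq (hA : IsPosDef A) (X Y : Submodule 𝕜 H) {m : ℕ}
    (hX : finrank 𝕜 X = m) : Fin m → ℝ :=
  ritzValues (Y.map (EnergySpace.ofBase hA).toLinearMap).starProjection_isSymmetric
    (X.map (EnergySpace.ofBase hA).toLinearMap)
    (((EnergySpace.ofBase hA).finrank_map_eq X).trans hX)

/-- The graph map of `Y` over `X` in the energy scalar product, expressed in `H`. -/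
theorem exists_energy_graph_map (hA : IsPosDef A) (X Y : Submodule 𝕜 H) {m : ℕ}
    (hX : finrank 𝕜 X = m) (hc : ∀ i, 0 < energyCosSq hA X Y hX i) :
    ∃ (u : Basis (Fin m) 𝕜 X) (W : X →ₗ[𝕜] Y),
      (∀ x y : X, inner 𝕜 (x : H) (A y) = ∑ i, inner 𝕜 (u.repr x i) (u.repr y i)) ∧
      (∀ x, RCLike.re (inner 𝕜 (W x : H) (A (W x))) =
        ∑ i, (energyCosSq hA X Y hX i)⁻¹ * ‖u.repr x i‖ ^ 2) ∧
      ∀ x y : X, inner 𝕜 (x : H) (A ((W y : H) - y)) = 0 := by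
  let e := EnergySpace.ofBase hA
  let eX : X ≃ₗ[𝕜] X.map e.toLinearMap := e.submoduleMap X
  let eY : Y ≃ₗ[𝕜] Y.map e.toLinearMap := e.submoduleMap Y
  obtain ⟨u, W, hW, horth⟩ := exists_graph_map _ _ _ hc
  refine ⟨u.toBasis.map eX.symm, eY.symm.toLinearMap ∘ₗ W ∘ₗ eX.toLinearMap, fun x y => ?_,
    fun x => ?_, fun x y => ?_⟩
  · have h := u.repr.inner_map_map (eX x) (eX y)
    rw [PiLp.inner_apply, Submodule.coe_inner] at h
    have h' : inner 𝕜 (x : H) (A y) =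
        inner 𝕜 (eX x : EnergySpace A hA) (eX y : EnergySpace A hA) := rfl
    rw [h', ← h]
    simp
  · have h := hW (eX x)
    rw [← inner_self_eq_norm_sq (𝕜 := 𝕜), Submodule.coe_inner] at h
    have h' : inner 𝕜 (eY.symm (W (eX x)) : H) (A (eY.symm (W (eX x)))) =
        inner 𝕜 (W (eX x) : EnergySpace A hA) (W (eX x) : EnergySpace A hA) := rfl
    change RCLike.re (inner 𝕜 (eY.symm (W (eX x)) : H) (A (eY.symm (W (eX x))))) = _
    rw [h', h]
    simp [energyCosSq]
  · exact horth (eX x) (eX y)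

/-- Angles smaller than `π/2` in the original scalar product are so in the energy scalar product
as well: both say that no nonzero vector of `X` is orthogonal to `Y`, as `X` is `A`-invariant. -/
theorem energyCosSq_pos (hA : IsPosDef A) (X Y : Submodule 𝕜 H) {m : ℕ} (hX : finrank 𝕜 X = m)
    (hXA : ∀ x ∈ X, A x ∈ X) (hΘ : ∀ i, principalAngles X Y hX i < Real.pi / 2) (i : Fin m) :
    0 < energyCosSq hA X Y hX i := by
  have hpos : ∀ j, 0 < ritzValues Y.starProjection_isSymmetric X hX j := fun j => by
    have h := hΘ j.rev
    rw [principalAngles, Real.arccos_lt_pi_div_two, Fin.rev_rev] at h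
    exact Real.sqrt_pos.mp h
  have htriv : ∀ z ∈ X, (∀ y ∈ Y, inner 𝕜 y z = 0) → z = 0 := by
    intro z hz hzY
    have hker : ritzOperator (Y.starProjection : H →ₗ[𝕜] H) X ⟨z, hz⟩ = 0 := by
      have : Y.starProjection z = 0 :=
        Y.starProjection_apply_eq_zero_iff.mpr ((Y.mem_orthogonal z).mpr hzY)
      simp [ritzOperator, this]
    by_contra hne
    have hdet := (ritzOperator_isSymmetric Y.starProjection_isSymmetric X).det_eq_prod_eigenvalues
      hX
    rw [LinearMap.det_eq_zero_iff_ker_ne_bot.mpr] at hdet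
    · exact Finset.prod_ne_zero_iff.mpr (fun j _ => by exact_mod_cast (hpos j).ne') hdet.symm
    · intro hbot
      have h0 := (Submodule.mem_bot 𝕜).mp (hbot ▸ LinearMap.mem_ker.mpr hker)
      exact hne (congrArg Subtype.val h0)
  let e := EnergySpace.ofBase hA
  set hS := ritzOperator_isSymmetric (Y.map e.toLinearMap).starProjection_isSymmetric
    (X.map e.toLinearMap)
  have hX' : finrank 𝕜 (X.map e.toLinearMap) = m := (e.finrank_map_eq X).trans hX
  set v := hS.eigenvectorBasis hX' i with hv
  have hnorm : ‖v‖ = 1 := (hS.eigenvectorBasis hX').orthonormal.1 i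
  have h1 : hS.eigenvalues hX' i = ‖(Y.map e.toLinearMap).starProjection (v : EnergySpace A hA)‖ ^ 2
      := by
    rw [← inner_self_eq_norm_sq (𝕜 := 𝕜), ← inner_starProjection_self]
    have h2 := inner_ritzOperator_left
      ((Y.map e.toLinearMap).starProjection : EnergySpace A hA →ₗ[𝕜] EnergySpace A hA) _ v v
    rw [hS.apply_eigenvectorBasis hX' i, inner_smul_left, RCLike.conj_ofReal] at h2
    have h3 := congrArg RCLike.re h2
    rw [RCLike.re_ofReal_mul, inner_self_eq_norm_sq, ← hv, hnorm] at h3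
    simpa using h3
  change 0 < hS.eigenvalues hX' i
  rw [h1]
  refine pow_pos (norm_pos_iff.mpr fun h0 => ?_) 2
  obtain ⟨x, hx, hxv⟩ := Submodule.mem_map.mp v.2
  have hAx : A x = 0 := by
    refine htriv _ (hXA x hx) fun y hy => ?_
    have h2 := (Submodule.mem_orthogonal _ _).mp
      (Submodule.starProjection_apply_eq_zero_iff _ |>.mp h0)
      (e y) (Submodule.mem_map_of_mem hy)
    rw [← hxv] at h2
    exact h2
  have hx0 : x = 0 := by
    by_contra hne
    have := hA.pos x hne
    simp [hAx] at this
  have : v = 0 := Subtype.ext (by rw [← hxv, hx0]; simp)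
  simp [this] at hnorm

/-- The eigenvalues `ν` are those of the form `∑ᵢ max(1/cᵢ, r) |xᵢ|²` on `X`, with `xᵢ` the
coordinates in the `A`-orthonormal basis of principal vectors. This form dominates both the
pullback of the energy under the graph map and `r` times the energy on `X`, while its operator is
the composition of `A` on `X` with a diagonal operator, so that its determinant is known. -/
theorem exists_eigenvalue_bounds (hA : IsPosDef A) (X Y : Submodule 𝕜 H) {m n : ℕ}
    (hX : finrank 𝕜 X = m) (hY : finrank 𝕜 Y = n) (hmn : m ≤ n) (hXA : ∀ x ∈ X, A x ∈ X)
    (hc : ∀ i, 0 < energyCosSq hA X Y hX i) {r : ℝ} (hr : 0 < r) :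
    ∃ ν : Fin m → ℝ,
      ∏ i, ν i = (∏ i, max (energyCosSq hA X Y hX i)⁻¹ r) *
        ∏ i, ritzValues hA.isSymmetric X hX i ∧
      ∀ i, lastEntries hmn (ritzValues hA.isSymmetric Y hY) i ≤ ν i ∧
        r * ritzValues hA.isSymmetric X hX i ≤ ν i := by
  obtain ⟨u, W, hu, hW, horth⟩ := exists_energy_graph_map hA X Y hX hc
  set c := energyCosSq hA X Y hX
  set τ : Fin m → ℝ := fun i => max (c i)⁻¹ r
  set hSX := ritzOperator_isSymmetric hA.isSymmetric X
  set hSY := ritzOperator_isSymmetric hA.isSymmetric Y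
  set M := ritzOperator A X ∘ₗ diagonalOperator u τ with hMdef
  have hM : ∀ x y, inner 𝕜 (M x) y = ∑ i, (τ i : 𝕜) * inner 𝕜 (u.repr x i) (u.repr y i) := by
    intro x y
    change inner 𝕜 (ritzOperator A X (diagonalOperator u τ x)) y = _
    rw [inner_ritzOperator_left, hA.isSymmetric, hu]
    refine Finset.sum_congr rfl fun i _ => ?_
    rw [repr_diagonalOperator, ← smul_eq_mul, inner_smul_left, RCLike.conj_ofReal]
  have hMsymm : M.IsSymmetric := by
    intro x y
    rw [hM, ← inner_conj_symm, hM, map_sum]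
    refine Finset.sum_congr rfl fun i _ => ?_
    rw [map_mul, RCLike.conj_ofReal, inner_conj_symm]
  have hMre : ∀ x, RCLike.re (inner 𝕜 (M x) x) = ∑ i, τ i * ‖u.repr x i‖ ^ 2 := by
    intro x
    rw [hM, map_sum]
    refine Finset.sum_congr rfl fun i _ => ?_
    rw [RCLike.re_ofReal_mul, inner_self_eq_norm_sq]
  have hMnonneg : ∀ x, 0 ≤ RCLike.re (inner 𝕜 (M x) x) := fun x => by
    rw [hMre]
    exact Finset.sum_nonneg fun i _ => mul_nonneg (hr.le.trans (le_max_right _ _)) (by positivity)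
  -- `A` maps `X` onto `X`, so `A`-orthogonality to `X` is orthogonality to `X`.
  have horth' : ∀ x y : X, inner 𝕜 (x : H) ((W y : H) - y) = 0 := by
    have hinj : Function.Injective (A.restrict hXA) := by
      rw [injective_iff_map_eq_zero]
      intro x hx
      have hAx : A x = 0 := congrArg Subtype.val hx
      by_contra hne
      have := hA.pos x (by simpa using hne)
      simp [hAx] at this
    intro x y
    obtain ⟨z, hz⟩ := LinearMap.surjective_of_injective hinj x
    have hz' : A z = x := congrArg Subtype.val hz
    rw [← hz', hA.isSymmetric]
    exact horth z y
  have hWnorm : ∀ x : X, ‖x‖ ≤ ‖W x‖ := by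
    intro x
    have h := norm_add_sq_eq_norm_sq_add_norm_sq_of_inner_eq_zero (x : H) ((W x : H) - x)
      (horth' x x)
    rw [add_sub_cancel] at h
    change ‖(x : H)‖ ≤ ‖(W x : H)‖
    nlinarith [norm_nonneg (x : H), norm_nonneg (W x : H), norm_nonneg ((W x : H) - x)]
  refine ⟨hMsymm.eigenvalues hX, ?_, fun i => ⟨?_, ?_⟩⟩
  · have h1 : LinearMap.det M =
        LinearMap.det (ritzOperator A X) * LinearMap.det (diagonalOperator u τ) :=
      LinearMap.det_comp _ _
    rw [hMsymm.det_eq_prod_eigenvalues hX, hSX.det_eq_prod_eigenvalues hX, det_diagonalOperator,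
      ← RCLike.ofReal_prod, ← RCLike.ofReal_prod, ← RCLike.ofReal_mul] at h1
    rw [RCLike.ofReal_inj.mp h1, mul_comm]
    rfl
  · have h := mul_eigenvalues_le hMsymm hSY hX hY W zero_le_one hWnorm hMnonneg (fun x => by
      rw [one_mul, hMre, inner_ritzOperator_left, hA.isSymmetric, hW]
      exact Finset.sum_le_sum fun k _ =>
        mul_le_mul_of_nonneg_right (le_max_left _ _) (by positivity))
      (i := i) (j := ⟨n - m + i.val, by omega⟩) (by simp only; omega)
    rwa [one_mul] at h
  · refine mul_eigenvalues_le hMsymm hSX hX hX LinearMap.id hr.le (fun x => le_rfl) hMnonneg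
      (fun x => ?_) le_rfl
    have hre : RCLike.re (inner 𝕜 (ritzOperator A X x) x) = ∑ k, ‖u.repr x k‖ ^ 2 := by
      rw [inner_ritzOperator_left, hA.isSymmetric, hu, map_sum]
      exact Finset.sum_congr rfl fun k _ => inner_self_eq_norm_sq _
    rw [LinearMap.id_apply, hre, hMre, Finset.mul_sum]
    exact Finset.sum_le_sum fun k _ =>
      mul_le_mul_of_nonneg_right (le_max_right _ _) (by positivity)

theorem lastEntries_eigenvalues_le_ritzValues (hA : IsPosDef A) (Y : Submodule 𝕜 H) {m n : ℕ}
    (hY : finrank 𝕜 Y = n) (hmn : m ≤ n) (hm : m ≤ finrank 𝕜 H) (i : Fin m) :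
    lastEntries hm (hA.isSymmetric.eigenvalues rfl) i ≤
      lastEntries hmn (ritzValues hA.isSymmetric Y hY) i := by
  have hle := hY ▸ Y.finrank_le
  have h := mul_eigenvalues_le (ritzOperator_isSymmetric hA.isSymmetric Y) hA.isSymmetric hY rfl
    Y.subtype zero_le_one (fun x => le_rfl)
    (fun x => by rw [inner_ritzOperator_left]; exact hA.re_inner_nonneg _)
    (fun x => by rw [inner_ritzOperator_left, one_mul]; rfl)
    (i := ⟨n - m + i.val, by omega⟩) (j := ⟨finrank 𝕜 H - m + i.val, by omega⟩)
    (by simp only; omega)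
  rwa [one_mul] at h

end Energy

end RayleighRitz

open RayleighRitz in
theorem theorem2p6 {𝕜 : Type*} [RCLike 𝕜] {H : Type*} [NormedAddCommGroup H]
    [InnerProductSpace 𝕜 H] [FiniteDimensional 𝕜 H]
    (A : H →ₗ[𝕜] H) (hA : IsPosDef A)
    (X Y : Submodule 𝕜 H) (m n : ℕ)
    (hX : Module.finrank 𝕜 X = m) (hY : Module.finrank 𝕜 Y = n) (hmn : m ≤ n)
    (hΘ : ∀ i, principalAngles X Y hX i < Real.pi / 2)
    (hXA : IsSmallestInvariant hA.isSymmetric X hX)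
    (ΛX ΛY ΘA : Fin m → ℝ)
    (hΛX : ΛX = ritzValues hA.isSymmetric X hX)
    (hΛY : ΛY = lastEntries hmn (ritzValues hA.isSymmetric Y hY))
    (hΘA : ΘA = energyAngles hA X Y hX) :
    (∀ i, 0 < ΛX i) ∧ (∀ i, 0 < ΛY i) ∧ (∀ i, ΘA i < Real.pi / 2) ∧
    (∀ i, 0 ≤ 1 - ΛX i / ΛY i ∧ 1 - ΛX i / ΛY i ≤ ⨆ j, Real.sin (ΘA j) ^ 2) ∧
    ((∀ i, 0 ≤ Real.log (ΛY i / ΛX i)) ∧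
      WeakMajorized (fun i => Real.log (ΛY i / ΛX i))
        (fun i => Real.log (1 + Real.tan (ΘA i) ^ 2))) ∧
    ((∀ i, 0 ≤ ΛY i / ΛX i - 1) ∧
      WeakMajorized (fun i => ΛY i / ΛX i - 1) (fun i => Real.tan (ΘA i) ^ 2)) := by
  set c := energyCosSq hA X Y hX with hcdef
  have hc : ∀ i, 0 < c i := energyCosSq_pos hA X Y hX hXA.1 hΘ
  have hc1 : ∀ i, c i ≤ 1 := ritzValues_starProjection_le_one _ _ _
  have hcanti : Antitone c := LinearMap.IsSymmetric.eigenvalues_antitone _ _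
  have hΘ_eq : ∀ i, ΘA i = Real.arccos √(c i.rev) := fun i => by rw [hΘA]; rfl
  have hcos : ∀ i, Real.cos (ΘA i) ^ 2 = c i.rev := fun i => by
    rw [hΘ_eq, Real.cos_arccos (by linarith [Real.sqrt_nonneg (c i.rev)])
      (Real.sqrt_le_one.mpr (hc1 _)), Real.sq_sqrt (hc _).le]
  have htan : ∀ i, 1 + Real.tan (ΘA i) ^ 2 = (c i.rev)⁻¹ := fun i => by
    rw [← hcos, ← Real.inv_one_add_tan_sq, inv_inv]
    intro h
    have := hcos i
    rw [h] at this
    exact (hc i.rev).ne (by simpa using this)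
  have hX0 : ∀ i, 0 < ΛX i := hΛX ▸ ritzValues_pos hA X hX
  have hY0 : ∀ i, 0 < ΛY i := hΛY ▸ fun i => ritzValues_pos hA Y hY _
  have hXY : ∀ i, ΛX i ≤ ΛY i := fun i => by
    rw [hΛX, hΛY, hXA.2]
    exact lastEntries_eigenvalues_le_ritzValues hA Y hY hmn _ i
  have hratio : ∀ i, 1 ≤ ΛY i / ΛX i := fun i => (one_le_div (hX0 i)).mpr (hXY i)
  have hρanti : Antitone fun i : Fin m => (c i.rev)⁻¹ := fun i j hij =>
    inv_anti₀ (hc _) (hcanti (Fin.rev_le_rev.mpr hij))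
  have hprod : ∀ s : Finset (Fin m), s.Nonempty →
      ∏ i ∈ s, ΛY i / ΛX i ≤ ∏ i : Fin m with i.val < s.card, (c i.rev)⁻¹ := by
    intro s hs
    refine prod_div_le_prod hX0 hY0 (fun i => inv_pos.mpr (hc _)) hρanti (fun r hr => ?_) hs
    obtain ⟨ν, h1, h2⟩ := exists_eigenvalue_bounds hA X Y hX hY hmn hXA.1 hc hr
    refine ⟨ν, ?_, fun i => ?_⟩
    · rw [h1, hΛX]
      congr 1
      exact (Equiv.prod_comp Fin.revPerm fun i => max (c i)⁻¹ r).symm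
    · rw [hΛX, hΛY]
      exact h2 i
  have hlog : WeakMajorized (fun i => Real.log (ΛY i / ΛX i))
      (fun i => Real.log (1 + Real.tan (ΘA i) ^ 2)) := by
    simp only [htan]
    refine weakMajorized_of_sum_le (fun i j hij =>
      Real.log_le_log (inv_pos.mpr (hc _)) (hρanti hij)) fun s hs => ?_
    rw [← Real.log_prod fun i _ => (zero_lt_one.trans_le (hratio i)).ne',
      ← Real.log_prod fun i _ => (inv_pos.mpr (hc _)).ne']
    exact Real.log_le_log (Finset.prod_pos fun i _ => zero_lt_one.trans_le (hratio i)) (hprod s hs)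
  refine ⟨hX0, hY0, fun i => ?_, fun i => ⟨?_, ?_⟩, ⟨fun i => Real.log_nonneg (hratio i), hlog⟩,
    fun i => sub_nonneg.mpr (hratio i), ?_⟩
  · rw [hΘ_eq, Real.arccos_lt_pi_div_two]
    exact Real.sqrt_pos.mpr (hc _)
  · exact sub_nonneg.mpr ((div_le_one (hY0 i)).mpr (hXY i))
  · -- The first entry of `ΘA` is its largest; the singleton `{i}` gives the bound on `ΛY i / ΛX i`.
    have hm : 0 < m := i.pos
    have h1 := hprod {i} (Finset.singleton_nonempty i)
    have h2 : (Finset.univ.filter fun j : Fin m => j.val < ({i} : Finset (Fin m)).card) =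
        {⟨0, hm⟩} := by
      ext j
      simp [Fin.ext_iff]
    rw [h2, Finset.prod_singleton, Finset.prod_singleton] at h1
    refine le_trans ?_ (le_ciSup (f := fun j => Real.sin (ΘA j) ^ 2)
      (Set.finite_range _).bddAbove ⟨0, hm⟩)
    have h3 := inv_anti₀ (div_pos (hY0 i) (hX0 i)) h1
    rw [inv_inv, inv_div] at h3
    simp only [Real.sin_sq, hcos]
    linarith
  · have h := hlog.exp_sub_one
    have h1 : ∀ i, Real.exp (Real.log (ΛY i / ΛX i)) = ΛY i / ΛX i := fun i =>
      Real.exp_log (div_pos (hY0 i) (hX0 i))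
    have h2 : ∀ i, Real.exp (Real.log (1 + Real.tan (ΘA i) ^ 2)) = 1 + Real.tan (ΘA i) ^ 2 :=
      fun i => Real.exp_log (by positivity)
    simpa only [h1, h2, add_sub_cancel_left] using h
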